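/- **Setting.** Let $d\ge 1$. Fix an orthonormal wavelet basis $\{\psi_\lambda\}_{\lambda\in\Lambda}$ of the real space $L_2(\mathbb R^d)$ consisting of the integer translates $\varphi(\cdot-k)$ of a scaling function (scale $|\lambda|=0$) and of the functions $2^{jd/2}\psi_e(2^j\cdot-k)$, $j\ge 0$, $k\in\mathbb Z^d$, $1\le e\le 2^d-1$ (scale $|\lambda|=j$), where $\varphi,\psi_e$ are real Schwartz functions and all moments of the $\psi_e$ vanish (e.g. the Lemarié–Meyer basis). For a real tempered distribution $u$ put $u_\lambda=\langle u,\psi_\lambda\rangle$. For $s\in\mathbb R$, $0<p<\infty$, the Besov space $B^s_p=B^s_{p,p}$ consists of the tempered distributions $u$ with finite (quasi-)norm $$\|u\|_{B^s_p}=\Big(\sum_{\lambda}2^{p(s+d(\frac12-\frac1p))|\lambda|}\,|u_\lambda|^p\Big)^{1/p},$$ and $\|u\|_{B^s_p}=\infty$ for $u\notin B^s_p$; $H^\sigma=B^\sigma_2$. Write $\mathcal B_X=B^{s_X}_{p_X}$ for $X\in\{D,S,G,R\}$, with $s_D,s_S,s_G\in\mathbb R$, $p_D>1$, $p_S,p_G>0$;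 $s_R,p_R$ are specified below. Let $F:\mathcal B_D\to L_2(\mathbb R^d)$ be linear and continuous, with adjoint $F^*:L_2(\mathbb R^d)\to\mathcal B_D^*$. Assume that $\mathcal B_G\subset\mathcal B_D^*$ continuously, and that $\mathcal B_G\subset\operatorname{rg}F^*$ (in particular this holds if $\operatorname{rg}F^*=\mathcal B_G$). Here a functional $\xi\in\mathcal B_D^*$ is identified with its wavelet coefficients $\xi_\lambda=\xi(\psi_\lambda)$. **Theorem.** Let $\mathcal B_S\subset\mathcal B_D$, $p_S\le p_G$, $u^\dagger\in\mathcal B_S$ and $v=Fu^\dagger$. Let $p>0$ with $p_S\le p\le\min\{p_D,p_G\}$, let $\varepsilon>0$, and let $$p_R=\frac{p+p_G}{p_G},\qquad s_R\le\frac{p\,s_S-p_Gs_G}{p+p_G}-d\,\frac{1}{p+p_G}\Big(\frac p{p_S}-1\Big)-\varepsilon\Big(\frac p{p_S}-1\Big),\qquad \sigma=s_R+d\Big(\frac12-\frac1{p_R}\Big).$$ Then for all constants $c_1,c_2>0$ there are $K,\delta_0>0$ such that for every $0<\delta\le\delta_0$, every $\alpha$ with $c_1\delta\le\alpha\le c_2\delta$,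 every $v^\delta\in L_2(\mathbb R^d)$ with $\|v-v^\delta\|_{L_2}\le\delta$, and every minimizer $u^{\alpha,\delta}$ over $\mathcal B_D$ of the Tikhonov functional $$T_\alpha(u)=\|Fu-v^\delta\|_{L_2}^2+\alpha\,\|u\|_{\mathcal B_R}^{p_R}\in[0,\infty],$$ one has $\|u^{\alpha,\delta}-u^\dagger\|_{H^\sigma}\le K\sqrt\delta$. That is, $\|u^{\alpha,\delta}-u^\dagger\|_{H^\sigma}=\mathcal O(\sqrt\delta)$ as $\delta\to0$ under the rule $\alpha\asymp\delta$. -/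

import Mathlib

open MeasureTheory
open scoped NNReal ENNReal SchwartzMap

noncomputable section

namespace BesovTikhonov

/-- Euclidean space `ℝ^d`. -/
abbrev Space (d : ℕ) : Type := EuclideanSpace ℝ (Fin d)

/-- Real tempered distributions on `ℝ^d`. -/
abbrev Tempered (d : ℕ) : Type := 𝓢(Space d, ℝ) →L[ℝ] ℝ

/-- The real Lebesgue space `L_2(ℝ^d)`. -/
abbrev L2 (d : ℕ) : Type := Lp ℝ 2 (volume : Measure (Space d))

/-- The regular tempered distribution `φ ↦ ∫ f φ` given by a Schwartz function `f`. -/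
def ofSchwartz {d : ℕ} (f : 𝓢(Space d, ℝ)) : Tempered d :=
  (SchwartzMap.integralCLM ℝ (volume : Measure (Space d))) ∘L
    (SchwartzMap.pairing (ContinuousLinearMap.mul ℝ ℝ) f)

/-- Wavelet indices `λ`: integer translates of the scaling function (`Sum.inl k`), and
`Sum.inr (j, e, k)` for the `e`-th mother wavelet at scale `j` and position `k`. -/
abbrev Index (d : ℕ) : Type :=
  (Fin d → ℤ) ⊕ (ℕ × Fin (2 ^ d - 1) × (Fin d → ℤ))

/-- The scale `|λ|` of a wavelet index. -/
def Index.level {d : ℕ} : Index d → ℕ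
  | Sum.inl _ => 0
  | Sum.inr (j, _, _) => j

/-- The dilation `x ↦ 2^j x` of `ℝ^d`. -/
def dyadicScale (d j : ℕ) : Space d ≃L[ℝ] Space d :=
  ContinuousLinearEquiv.smulLeft (Units.mk0 ((2 : ℝ) ^ j) (by positivity))

/-- The function `x ↦ 2^{jd/2} f(2^j x - k)`; see `dyadic_apply`. -/
def dyadic {d : ℕ} (f : 𝓢(Space d, ℝ)) (j : ℕ) (k : Fin d → ℤ) : 𝓢(Space d, ℝ) :=
  ((2 : ℝ) ^ ((j : ℝ) * d / 2)) •
    SchwartzMap.compCLMOfContinuousLinearEquiv ℝ (dyadicScale d j)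
      (SchwartzMap.compSubConstCLM ℝ (WithLp.toLp 2 fun i => (k i : ℝ)) f)

theorem dyadic_apply {d : ℕ} (f : 𝓢(Space d, ℝ)) (j : ℕ) (k : Fin d → ℤ) (x : Space d) :
    dyadic f j k x = (2 : ℝ) ^ ((j : ℝ) * d / 2) *
      f ((2 : ℝ) ^ j • x - WithLp.toLp 2 fun i => (k i : ℝ)) := rfl

/-- The system generated by a scaling function and mother wavelets: all integer translates of the
scaling function and all the functions `2^{jd/2} ψ_e(2^j x - k)` with `j ≥ 0`. -/
def waveletSystem {d : ℕ} (father : 𝓢(Space d, ℝ)) (mother : Fin (2 ^ d - 1) → 𝓢(Space d, ℝ)) :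
    Index d → 𝓢(Space d, ℝ)
  | Sum.inl k => dyadic father 0 k
  | Sum.inr (j, e, k) => dyadic (mother e) j k

/-- A (smooth, rapidly decaying) orthonormal wavelet basis of `L_2(ℝ^d)`, for example the
Lemarié–Meyer basis: scaling function and mother wavelets are Schwartz functions, all moments of
the mother wavelets vanish, and the generated system is an orthonormal basis. Such a basis
characterizes the Besov spaces `B^s_{p,p}` of all orders `s` and all exponents `0 < p < ∞`. -/
structure WaveletBasis (d : ℕ) where
  father : 𝓢(Space d, ℝ)
  mother : Fin (2 ^ d - 1) → 𝓢(Space d, ℝ)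
  moments : ∀ (e : Fin (2 ^ d - 1)) (a : Fin d → ℕ),
    ∫ x : Space d, (∏ i, x i ^ a i) * mother e x = 0
  orthonormal : ∀ l m : Index d,
    ∫ x : Space d, waveletSystem father mother l x * waveletSystem father mother m x =
      if l = m then 1 else 0
  complete : ∀ f : L2 d,
    (∀ l : Index d, ∫ x : Space d, f x * waveletSystem father mother l x = 0) → f = 0

namespace WaveletBasis

variable {d : ℕ} (W : WaveletBasis d)

/-- The basis function `ψ_λ`. -/
def psi (l : Index d) : 𝓢(Space d, ℝ) := waveletSystem W.father W.mother l

/-- The wavelet coefficients `u_λ = ⟨u, ψ_λ⟩` of a tempered distribution. -/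
def coeff (u : Tempered d) (l : Index d) : ℝ := u (W.psi l)

theorem coeff_ofSchwartz_psi (l m : Index d) :
    W.coeff (ofSchwartz (W.psi l)) m = if l = m then 1 else 0 :=
  W.orthonormal l m

end WaveletBasis

/-- The wavelet (quasi-)norm of `B^s_p`, as a function of the wavelet coefficients:
`(∑_λ 2^{p (s + d(1/2 - 1/p)) |λ|} |c_λ|^p)^{1/p} ∈ [0,∞]`. -/
def seqNorm {d : ℕ} (s p : ℝ) (c : Index d → ℝ) : ℝ≥0∞ :=
  (∑' l : Index d, ENNReal.ofReal
    ((2 : ℝ) ^ (p * (s + d * (1 / 2 - 1 / p)) * l.level) * |c l| ^ p)) ^ (1 / p)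

theorem seqNorm_lt_top_iff {d : ℕ} {s p : ℝ} (hp : 0 < p) (c : Index d → ℝ) :
    seqNorm s p c < ⊤ ↔ ∑' l : Index d, ENNReal.ofReal
      ((2 : ℝ) ^ (p * (s + d * (1 / 2 - 1 / p)) * l.level) * |c l| ^ p) < ⊤ := by
  unfold seqNorm
  exact ENNReal.rpow_lt_top_iff_of_pos (by positivity)

theorem abs_add_rpow_le {p : ℝ} (hp : 0 < p) (a b : ℝ) :
    |a + b| ^ p ≤ 2 ^ p * (|a| ^ p + |b| ^ p) := by
  have h1 : |a + b| ≤ 2 * max |a| |b| := by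
    have := abs_add_le a b
    have := le_max_left |a| |b|
    have := le_max_right |a| |b|
    linarith
  have h2 : |a + b| ^ p ≤ (2 * max |a| |b|) ^ p :=
    Real.rpow_le_rpow (abs_nonneg _) h1 hp.le
  rw [Real.mul_rpow (by norm_num) (le_max_of_le_left (abs_nonneg _))] at h2
  refine h2.trans (mul_le_mul_of_nonneg_left ?_ (by positivity))
  have ha : 0 ≤ |a| ^ p := by positivity
  have hb : 0 ≤ |b| ^ p := by positivity
  rcases max_cases |a| |b| with h | h <;> rw [h.1] <;> linarith

theorem seqNorm_add_lt_top {d : ℕ} {s p : ℝ} (hp : 0 < p) {a b : Index d → ℝ}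
    (ha : seqNorm s p a < ⊤) (hb : seqNorm s p b < ⊤) :
    seqNorm s p (fun l => a l + b l) < ⊤ := by
  rw [seqNorm_lt_top_iff hp] at *
  refine lt_of_le_of_lt (ENNReal.tsum_le_tsum (g := fun l : Index d =>
    ENNReal.ofReal (2 ^ p) * (ENNReal.ofReal
      ((2 : ℝ) ^ (p * (s + d * (1 / 2 - 1 / p)) * l.level) * |a l| ^ p) + ENNReal.ofReal
      ((2 : ℝ) ^ (p * (s + d * (1 / 2 - 1 / p)) * l.level) * |b l| ^ p))) fun l => ?_) ?_
  · rw [← ENNReal.ofReal_add (by positivity) (by positivity),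
      ← ENNReal.ofReal_mul (by positivity)]
    apply ENNReal.ofReal_le_ofReal
    have h := mul_le_mul_of_nonneg_left (abs_add_rpow_le hp (a l) (b l))
      (show (0 : ℝ) ≤ (2 : ℝ) ^ (p * (s + d * (1 / 2 - 1 / p)) * l.level) by positivity)
    calc _ ≤ _ := h
      _ = _ := by ring
  · rw [ENNReal.tsum_mul_left, ENNReal.tsum_add]
    exact ENNReal.mul_lt_top ENNReal.ofReal_lt_top (ENNReal.add_lt_top.2 ⟨ha, hb⟩)

theorem seqNorm_smul_lt_top {d : ℕ} {s p : ℝ} (hp : 0 < p) (r : ℝ) {a : Index d → ℝ}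
    (ha : seqNorm s p a < ⊤) : seqNorm s p (fun l => r * a l) < ⊤ := by
  rw [seqNorm_lt_top_iff hp] at *
  have h : ∀ l : Index d, ENNReal.ofReal
      ((2 : ℝ) ^ (p * (s + d * (1 / 2 - 1 / p)) * l.level) * |r * a l| ^ p) =
      ENNReal.ofReal (|r| ^ p) * ENNReal.ofReal
      ((2 : ℝ) ^ (p * (s + d * (1 / 2 - 1 / p)) * l.level) * |a l| ^ p) := by
    intro l
    rw [← ENNReal.ofReal_mul (by positivity), abs_mul,
      Real.mul_rpow (abs_nonneg _) (abs_nonneg _)]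
    congr 1
    ring
  rw [tsum_congr h, ENNReal.tsum_mul_left]
  exact ENNReal.mul_lt_top ENNReal.ofReal_lt_top ha

namespace WaveletBasis

variable {d : ℕ} (W : WaveletBasis d)

/-- The Besov (quasi-)norm `‖u‖_{B^s_p} ∈ [0,∞]` of a tempered distribution, with the value `∞`
exactly for `u ∉ B^s_p`. -/
def besovNorm (s p : ℝ) (u : Tempered d) : ℝ≥0∞ := seqNorm s p (W.coeff u)

/-- The Besov space `B^s_p = B^s_{p,p}`, a subspace of the tempered distributions. -/
def besov (s p : ℝ) (hp : 0 < p) : Submodule ℝ (Tempered d) where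
  carrier := {u | W.besovNorm s p u < ⊤}
  add_mem' := fun ha hb => seqNorm_add_lt_top hp ha hb
  zero_mem' := by
    change seqNorm s p (W.coeff 0) < ⊤
    rw [seqNorm_lt_top_iff hp]
    simp [coeff, Real.zero_rpow hp.ne']
  smul_mem' := fun r _ ha => seqNorm_smul_lt_top hp r ha

theorem mem_besov {s p : ℝ} {hp : 0 < p} {u : Tempered d} :
    u ∈ W.besov s p hp ↔ W.besovNorm s p u < ⊤ := Iff.rfl

theorem psi_mem_besov (s p : ℝ) (hp : 0 < p) (l : Index d) :
    ofSchwartz (W.psi l) ∈ W.besov s p hp := by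
  rw [mem_besov, besovNorm, seqNorm_lt_top_iff hp, tsum_eq_single l]
  · exact ENNReal.ofReal_lt_top
  · intro m hm
    simp [coeff_ofSchwartz_psi, hm.symm, Real.zero_rpow hp.ne']

/-- The basis function `ψ_λ` as an element of `B^s_p`. -/
def basisElt (s p : ℝ) (hp : 0 < p) (l : Index d) : W.besov s p hp :=
  ⟨ofSchwartz (W.psi l), W.psi_mem_besov s p hp l⟩

/-- A linear operator `F : B^s_p → L_2` is continuous if it is bounded for the Besov norm. -/
def IsBoundedOp {s p : ℝ} {hp : 0 < p} (F : W.besov s p hp →ₗ[ℝ] L2 d) : Prop :=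
  ∃ C : ℝ≥0, ∀ u : W.besov s p hp, ‖F u‖ₑ ≤ C * W.besovNorm s p u

/-- The dual `(B^s_p)^*`: the linear functionals which are bounded for the Besov norm. -/
def dual (s p : ℝ) (hp : 0 < p) : Set (W.besov s p hp →ₗ[ℝ] ℝ) :=
  {ξ | ∃ C : ℝ≥0, ∀ u : W.besov s p hp, ‖ξ u‖ₑ ≤ C * W.besovNorm s p u}

/-- The continuous embedding `B^{s₁}_{p₁} ⊂ (B^s_p)^*`: each `g ∈ B^{s₁}_{p₁}` acts on `B^s_p` as
a functional `ξ` which extends the action of the distribution `g` on the basis functions, and the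
norm of `ξ` is bounded by a constant times the norm of `g`. -/
def EmbedsInDual (s₁ p₁ : ℝ) (hp₁ : 0 < p₁) (s p : ℝ) (hp : 0 < p) : Prop :=
  ∃ C : ℝ≥0, ∀ g ∈ W.besov s₁ p₁ hp₁, ∃ ξ : W.besov s p hp →ₗ[ℝ] ℝ,
    (∀ l, ξ (W.basisElt s p hp l) = W.coeff g l) ∧
    ∀ u : W.besov s p hp, ‖ξ u‖ₑ ≤ C * W.besovNorm s₁ p₁ g * W.besovNorm s p u

/-- `B^{s₁}_{p₁}` as a subset of `(B^s_p)^*`: the bounded functionals `ξ` whose wavelet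
coefficients `ξ_λ = ξ(ψ_λ)` have finite `B^{s₁}_{p₁}`-norm. -/
def besovInDual (s₁ p₁ s p : ℝ) (hp : 0 < p) : Set (W.besov s p hp →ₗ[ℝ] ℝ) :=
  {ξ | ξ ∈ W.dual s p hp ∧ seqNorm s₁ p₁ (fun l => ξ (W.basisElt s p hp l)) < ⊤}

/-- The adjoint `F^* : L_2 → (B^s_p)^*`, `(F^* w)(u) = ⟨w, F u⟩`. -/
def adjoint {s p : ℝ} {hp : 0 < p} (F : W.besov s p hp →ₗ[ℝ] L2 d) (w : L2 d) :
    W.besov s p hp →ₗ[ℝ] ℝ :=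
  (innerₗ (L2 d) w) ∘ₗ F

theorem adjoint_apply {s p : ℝ} {hp : 0 < p} (F : W.besov s p hp →ₗ[ℝ] L2 d) (w : L2 d)
    (u : W.besov s p hp) : W.adjoint F w u = inner ℝ w (F u) := rfl

/-- The Tikhonov functional `T_α(u) = ‖F u - v^δ‖² + α ‖u‖_{B^{s_R}_{p_R}}^{p_R} ∈ [0,∞]` on
`B^s_p`, the domain of `F`. -/
def tikhonov {s p : ℝ} {hp : 0 < p} (F : W.besov s p hp →ₗ[ℝ] L2 d) (sR pR : ℝ) (vδ : L2 d)
    (α : ℝ) (u : W.besov s p hp) : ℝ≥0∞ :=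
  ‖F u - vδ‖ₑ ^ 2 + ENNReal.ofReal α * W.besovNorm sR pR u ^ pR

/-- `u` minimizes the Tikhonov functional over `B^s_p`. -/
def IsTikhonovMinimizer {s p : ℝ} {hp : 0 < p} (F : W.besov s p hp →ₗ[ℝ] L2 d) (sR pR : ℝ)
    (vδ : L2 d) (α : ℝ) (u : W.besov s p hp) : Prop :=
  ∀ u' : W.besov s p hp, W.tikhonov F sR pR vδ α u ≤ W.tikhonov F sR pR vδ α u'

/-- The norm of the Sobolev space `H^σ = B^σ_{2,2}`. -/
def sobolevNorm (σ : ℝ) (u : Tempered d) : ℝ≥0∞ := W.besovNorm σ 2 u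

end WaveletBasis

end BesovTikhonov

end

/-! With `τ = sR + d(1/2 - 1/pR) = σ`, the penalty is the plain sum of `|2^(σ|λ|) u_λ|^pR`, where `1
< pR ≤ 2` because `0 < p ≤ pG`. The bound on `sR` is the exponent balance that puts its derivative
at `u†` into `B_G` (`seqNorm_penaltyGradient_lt_top`). Since `B_G` lies in the range of `F^*`, this
derivative equals `F^* w`: a source condition. Comparing the values of `T_α` at the minimizer and at
`u†` then bounds the Bregman distance of the penalty by `δ²/α + ‖w‖δ + α‖w‖²/4`, which is `O(δ)` for
`α ≍ δ` (`bregman_le_of_tikhonov_le`).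

Minimality also keeps the penalty bounded, and on bounded sets strong convexity of `|t|^pR` makes
the Bregman distance dominate the squared `ℓ_2` distance of the rescaled coefficients
(`summable_sq_and_tsum_le_bregman`). That is the squared `H^σ` norm, so taking square roots gives
the rate. -/

namespace BesovTikhonov

/-! ### Scalar convexity -/

/-- Strong convexity of `t ↦ |t| ^ q` on bounded intervals, for `1 < q ≤ 2`. -/
theorem abs_rpow_strong_convexity {q M a b : ℝ} (hq : 1 < q) (hq2 : q ≤ 2) (hM : 0 < M)
    (ha : |a| ≤ M) (hb : |b| ≤ M) :
    q * (q - 1) / 2 * M ^ (q - 2) * (b - a) ^ 2 ≤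
      |b| ^ q - |a| ^ q - q * |a| ^ (q - 2) * a * (b - a) := by
  -- Half the minimum of the second derivative `q(q-1)|t|^(q-2)` over `0 < |t| ≤ M`, attained at
  -- `|t| = M` as `q ≤ 2`. Hence `g` is convex on `[-M, M]`, and the claim is its tangent inequality
  -- at `a`.
  set c : ℝ := q * (q - 1) / 2 * M ^ (q - 2) with hc
  set g : ℝ → ℝ := fun t => |t| ^ q - c * t ^ 2 with hg
  set g' : ℝ → ℝ := fun t => q * |t| ^ (q - 2) * t - 2 * c * t with hg'
  have hd : ∀ t, HasDerivAt g (g' t) t := by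
    intro t
    have h2 : HasDerivAt (fun t : ℝ => c * t ^ 2) (2 * c * t) t :=
      ((hasDerivAt_pow 2 t).const_mul c).congr_deriv (by push_cast; ring)
    exact (hasDerivAt_abs_rpow t hq).sub h2
  have hpos : ∀ t : ℝ, 0 < t → g' t = q * t ^ (q - 1) - 2 * c * t := by
    intro t ht
    simp only [hg', abs_of_pos ht]
    rw [show q - 1 = (q - 2) + 1 by ring, Real.rpow_add_one ht.ne']
    ring
  have hodd : ∀ t : ℝ, g' (-t) = - g' t := by
    intro t; simp only [hg', abs_neg]; ring
  -- For `q < 2` the second derivative blows up at `0`, so monotonicity of `g'` is proved on `(0,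
  -- M]` and carried across `0` by oddness and sign.
  have hmono0 : MonotoneOn g' (Set.Ioc 0 M) := by
    have h : MonotoneOn (fun t : ℝ => q * t ^ (q - 1) - 2 * c * t) (Set.Ioc 0 M) := by
      have hder : ∀ t ∈ Set.Ioc (0 : ℝ) M, HasDerivAt (fun t : ℝ => q * t ^ (q - 1) - 2 * c * t)
          (q * ((q - 1) * t ^ (q - 1 - 1)) - 2 * c) t := by
        intro t ht
        have h1 := (Real.hasDerivAt_rpow_const (x := t) (p := q - 1) (Or.inl ht.1.ne')).const_mul q
        have h2 := (hasDerivAt_id t).const_mul (2 * c)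
        rw [mul_one] at h2
        exact h1.sub h2
      refine monotoneOn_of_deriv_nonneg (convex_Ioc _ _)
        (fun t ht => (hder t ht).continuousAt.continuousWithinAt)
        (fun t ht => (hder t (interior_subset ht)).differentiableAt.differentiableWithinAt) ?_
      intro t ht
      have ht := interior_subset ht
      rw [(hder t ht).deriv, hc, show q - 1 - 1 = q - 2 by ring]
      have h3 : M ^ (q - 2) ≤ t ^ (q - 2) :=
        Real.rpow_le_rpow_of_nonpos ht.1 ht.2 (by linarith)
      have h4 : 0 ≤ q * (q - 1) := by nlinarith
      nlinarith [mul_le_mul_of_nonneg_left h3 h4]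
    intro s hs t ht hst
    rw [hpos s hs.1, hpos t ht.1]
    exact h hs ht hst
  have h0 : g' 0 = 0 := by simp [hg']
  have hnn : ∀ t ∈ Set.Ioc (0 : ℝ) M, 0 ≤ g' t := by
    intro t ht
    rw [hpos t ht.1, show q - 1 = (q - 2) + 1 by ring, Real.rpow_add_one ht.1.ne', hc]
    have h3 : M ^ (q - 2) ≤ t ^ (q - 2) :=
      Real.rpow_le_rpow_of_nonpos ht.1 ht.2 (by linarith)
    have h5 : 0 < M ^ (q - 2) := by positivity
    have h6 : (q - 1) * M ^ (q - 2) ≤ t ^ (q - 2) := by nlinarith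
    have h7 := mul_le_mul_of_nonneg_left h6 (mul_nonneg (by linarith : 0 ≤ q) ht.1.le)
    linarith
  have hmono : MonotoneOn g' (Set.Icc (-M) M) := by
    intro s hs t ht hst
    rcases lt_trichotomy s 0 with h | h | h
    · have hs' : -s ∈ Set.Ioc (0 : ℝ) M := ⟨by linarith, by linarith [hs.1]⟩
      have e : g' s = - g' (-s) := by rw [hodd]; ring
      rcases lt_trichotomy t 0 with h' | h' | h'
      · have ht' : -t ∈ Set.Ioc (0 : ℝ) M := ⟨by linarith, by linarith [ht.1]⟩
        have := hmono0 ht' hs' (by linarith)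
        rw [hodd, hodd] at this
        linarith
      · rw [h', h0, e]; linarith [hnn _ hs']
      · linarith [hnn _ hs', hnn t ⟨h', ht.2⟩]
    · rw [h, h0]
      rcases (h ▸ hst).eq_or_lt with h' | h'
      · rw [← h', h0]
      · exact hnn t ⟨h', ht.2⟩
    · exact hmono0 ⟨h, hs.2⟩ ⟨h.trans_le hst, ht.2⟩ hst
  have hconv : ConvexOn ℝ (Set.Icc (-M) M) g := by
    refine MonotoneOn.convexOn_of_deriv (convex_Icc _ _)
      (fun t _ => (hd t).continuousAt.continuousWithinAt)
      (fun t _ => (hd t).differentiableAt.differentiableWithinAt) ?_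
    intro s hs t ht hst
    rw [(hd s).deriv, (hd t).deriv]
    exact hmono (interior_subset hs) (interior_subset ht) hst
  have hamem : a ∈ Set.Icc (-M) M := abs_le.1 ha
  have hbmem : b ∈ Set.Icc (-M) M := abs_le.1 hb
  have key : g a + g' a * (b - a) ≤ g b := by
    rcases lt_trichotomy a b with h | h | h
    · have := hconv.le_slope_of_hasDerivAt hamem hbmem h (hd a)
      rw [slope_def_field, le_div_iff₀ (by linarith)] at this
      linarith
    · simp [h]
    · have := hconv.slope_le_of_hasDerivAt hbmem hamem h (hd a)
      rw [slope_def_field, div_le_iff₀ (by linarith)] at this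
      linarith
  simp only [hg, hg'] at key
  linarith

/-! ### Besov norms as rescaled `ℓ_p` norms -/

theorem seqNorm_mono {d : ℕ} {s p : ℝ} (hp : 0 < p) {a b : Index d → ℝ}
    (h : ∀ l, |a l| ≤ |b l|) : seqNorm s p a ≤ seqNorm s p b := by
  unfold seqNorm
  refine ENNReal.rpow_le_rpow (ENNReal.tsum_le_tsum fun l => ENNReal.ofReal_le_ofReal ?_)
    (by positivity)
  exact mul_le_mul_of_nonneg_left (Real.rpow_le_rpow (abs_nonneg _) (h l) hp.le) (by positivity)

theorem tsum_ofReal_lt_top_iff {ι : Type*} {f : ι → ℝ} (hf : ∀ i, 0 ≤ f i) :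
    ∑' i, ENNReal.ofReal (f i) < ⊤ ↔ Summable f := by
  constructor
  · intro h
    have := ENNReal.summable_toReal h.ne
    simpa [ENNReal.toReal_ofReal (hf _)] using this
  · intro h
    rw [← ENNReal.ofReal_tsum_of_nonneg hf h]
    exact ENNReal.ofReal_lt_top

theorem weight_mul_abs_rpow (p τ x : ℝ) (n : ℕ) :
    (2 : ℝ) ^ (p * τ * n) * |x| ^ p = |2 ^ (τ * n) * x| ^ p := by
  have h : (0 : ℝ) < 2 ^ (τ * n) := by positivity
  rw [abs_mul, Real.mul_rpow (abs_nonneg _) (abs_nonneg _), abs_of_pos h,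
    ← Real.rpow_mul (by norm_num)]
  congr 2; ring

/-- Membership in `B^s_p` means that the rescaled coefficients are in `ℓ_p`. -/
theorem seqNorm_lt_top_iff_summable {d : ℕ} {s p : ℝ} (hp : 0 < p) (c : Index d → ℝ) :
    seqNorm s p c < ⊤ ↔
      Summable fun l => |2 ^ ((s + d * (1 / 2 - 1 / p)) * l.level) * c l| ^ p := by
  rw [seqNorm_lt_top_iff hp, tsum_ofReal_lt_top_iff fun _ => by positivity]
  simp only [weight_mul_abs_rpow]

theorem seqNorm_rpow {d : ℕ} {s p : ℝ} (hp : 0 < p) (c : Index d → ℝ) :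
    seqNorm s p c ^ p =
      ∑' l, ENNReal.ofReal (|2 ^ ((s + d * (1 / 2 - 1 / p)) * l.level) * c l| ^ p) := by
  unfold seqNorm
  rw [← ENNReal.rpow_mul, one_div_mul_cancel hp.ne', ENNReal.rpow_one]
  simp only [weight_mul_abs_rpow]

/-- Summability forces all but finitely many `f i` to be at most `1`, where raising the exponent
decreases the power. -/
theorem summable_rpow_of_exponent_le {ι : Type*} {f : ι → ℝ} (hf : ∀ i, 0 ≤ f i) {p q : ℝ}
    (hp : 0 < p) (hpq : p ≤ q) (h : Summable fun i => f i ^ p) : Summable fun i => f i ^ q := by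
  refine Summable.of_norm_bounded_eventually h ?_
  filter_upwards [h.tendsto_cofinite_zero.eventually (gt_mem_nhds zero_lt_one)] with i hi
  rw [Real.norm_of_nonneg (Real.rpow_nonneg (hf i) _)]
  have h1 : f i ≤ 1 := by
    by_contra! hlt
    exact absurd (Real.one_lt_rpow hlt hp) (not_lt.2 (le_of_lt hi))
  rcases (hf i).eq_or_lt with h0 | h0
  · simp [← h0, Real.zero_rpow hp.ne', Real.zero_rpow (hp.trans_le hpq).ne']
  · exact Real.rpow_le_rpow_of_exponent_ge h0 h1 hpq

/-! ### The duality pairing in wavelet coefficients -/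

namespace WaveletBasis

variable {d : ℕ} (W : WaveletBasis d)

/-- Linearity of the wavelet coefficients on finite wavelet sums. -/
theorem coeff_sum_smul_psi (S : Finset (Index d)) (a : Index d → ℝ) (m : Index d) :
    W.coeff (∑ l ∈ S, a l • ofSchwartz (W.psi l)) m = if m ∈ S then a m else 0 := by
  have h : W.coeff (∑ l ∈ S, a l • ofSchwartz (W.psi l)) m =
      ∑ l ∈ S, a l * W.coeff (ofSchwartz (W.psi l)) m := by
    simp [coeff]
  simp [h, coeff_ofSchwartz_psi]

/-- The embedding `B^{s₁}_{p₁} ⊂ (B^s_p)^*` bounds the pairing of coefficient sequences. -/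
theorem EmbedsInDual.exists_sum_abs_le {s₁ p₁ s p : ℝ} {hp₁ : 0 < p₁} {hp : 0 < p}
    (h : W.EmbedsInDual s₁ p₁ hp₁ s p hp) :
    ∃ C : ℝ≥0, ∀ (a : Index d → ℝ) (u : W.besov s p hp) (S : Finset (Index d)),
      ENNReal.ofReal (∑ l ∈ S, |a l * W.coeff u l|) ≤
        C * seqNorm s₁ p₁ a * W.besovNorm s p u := by
  obtain ⟨C, hC⟩ := h
  refine ⟨C, fun a u S => ?_⟩
  obtain ⟨ξ, hξ, hb⟩ := hC (∑ l ∈ S, a l • ofSchwartz (W.psi l))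
    (Submodule.sum_mem _ fun l _ => Submodule.smul_mem _ _ (W.psi_mem_besov s₁ p₁ hp₁ l))
  -- Choosing signs termwise turns the pairing into a sum of absolute values without increasing the
  -- Besov norm, which depends only on `|e l|`.
  set e : Index d → ℝ := fun l => (SignType.sign (a l * W.coeff u l) : ℝ) * W.coeff u l with he
  have h1 := hb (∑ l ∈ S, e l • W.basisElt s p hp l)
  have h2 : ξ (∑ l ∈ S, e l • W.basisElt s p hp l) = ∑ l ∈ S, |a l * W.coeff u l| := by
    rw [map_sum]
    refine Finset.sum_congr rfl fun l hl => ?_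
    rw [map_smul, hξ, coeff_sum_smul_psi, if_pos hl, smul_eq_mul, he, ← sign_mul_self]
    ring
  have h3 : W.besovNorm s₁ p₁ (∑ l ∈ S, a l • ofSchwartz (W.psi l)) ≤ seqNorm s₁ p₁ a := by
    refine seqNorm_mono hp₁ fun l => ?_
    rw [coeff_sum_smul_psi]
    split_ifs <;> simp
  have h4 : W.besovNorm s p ((∑ l ∈ S, e l • W.basisElt s p hp l : W.besov s p hp) : Tempered d) ≤
      W.besovNorm s p u := by
    refine seqNorm_mono hp fun l => ?_
    have h5 : ((∑ l ∈ S, e l • W.basisElt s p hp l : W.besov s p hp) : Tempered d) =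
        ∑ l ∈ S, e l • ofSchwartz (W.psi l) := by
      simp [basisElt]
    rw [h5, coeff_sum_smul_psi]
    split_ifs
    · rw [he, abs_mul]
      refine mul_le_of_le_one_left (abs_nonneg _) ?_
      rcases SignType.sign (a l * W.coeff u l) with _ | _ | _ <;> simp
    · simp
  rw [h2, Real.enorm_eq_ofReal (Finset.sum_nonneg fun _ _ => abs_nonneg _)] at h1
  exact h1.trans (by gcongr)

theorem EmbedsInDual.summable_mul {s₁ p₁ s p : ℝ} {hp₁ : 0 < p₁} {hp : 0 < p}
    (h : W.EmbedsInDual s₁ p₁ hp₁ s p hp) {a : Index d → ℝ} (ha : seqNorm s₁ p₁ a < ⊤)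
    (u : W.besov s p hp) : Summable fun l => a l * W.coeff u l := by
  obtain ⟨C, hC⟩ := h.exists_sum_abs_le
  have hfin : C * seqNorm s₁ p₁ a * W.besovNorm s p u ≠ ⊤ :=
    (ENNReal.mul_lt_top (ENNReal.mul_lt_top ENNReal.coe_lt_top ha) u.2).ne
  refine Summable.of_abs (summable_of_sum_le (c := (C * seqNorm s₁ p₁ a * W.besovNorm s p u).toReal)
    (fun _ => abs_nonneg _) fun S => ?_)
  exact (ENNReal.ofReal_le_iff_le_toReal hfin).1 (hC a u S)

/-- The functional on `B^s_p` with a given coefficient sequence from `B^{s₁}_{p₁} ⊂ (B^s_p)^*`. -/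
theorem EmbedsInDual.exists_mem_besovInDual {s₁ p₁ s p : ℝ} {hp₁ : 0 < p₁} {hp : 0 < p}
    (h : W.EmbedsInDual s₁ p₁ hp₁ s p hp) {a : Index d → ℝ} (ha : seqNorm s₁ p₁ a < ⊤) :
    ∃ ξ ∈ W.besovInDual s₁ p₁ s p hp, ∀ u, ξ u = ∑' l, a l * W.coeff u l := by
  have hsum := h.summable_mul W ha
  obtain ⟨C, hC⟩ := h.exists_sum_abs_le
  let ξ : W.besov s p hp →ₗ[ℝ] ℝ :=
    { toFun := fun u => ∑' l, a l * W.coeff u l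
      map_add' := fun u u' => by
        rw [← (hsum u).tsum_add (hsum u')]
        refine tsum_congr fun l => ?_
        simp [coeff, mul_add]
      map_smul' := fun r u => by
        rw [RingHom.id_apply, smul_eq_mul, ← tsum_mul_left]
        refine tsum_congr fun l => ?_
        simp [coeff]; ring }
  refine ⟨ξ, ⟨⟨C * (seqNorm s₁ p₁ a).toNNReal, fun u => ?_⟩, ?_⟩, fun _ => rfl⟩
  · have hfin : C * seqNorm s₁ p₁ a * W.besovNorm s p u ≠ ⊤ :=
      (ENNReal.mul_lt_top (ENNReal.mul_lt_top ENNReal.coe_lt_top ha) u.2).ne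
    rw [ENNReal.coe_mul, ENNReal.coe_toNNReal ha.ne, ← ofReal_norm,
      ENNReal.ofReal_le_iff_le_toReal hfin]
    refine (norm_tsum_le_tsum_norm (hsum u).norm).trans ?_
    exact (hsum u).norm.tsum_le_of_sum_le fun S =>
      (ENNReal.ofReal_le_iff_le_toReal hfin).1 (hC a u S)
  · have hξ : (fun l => ξ (W.basisElt s p hp l)) = a := by
      funext l
      change ∑' m, a m * W.coeff (ofSchwartz (W.psi l)) m = a l
      rw [tsum_eq_single l]
      · simp [coeff_ofSchwartz_psi]
      · intro m hm
        simp [coeff_ofSchwartz_psi, hm.symm]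
    rwa [hξ]

end WaveletBasis

/-! ### The source condition -/

/-- Coefficients of the derivative of `u ↦ ‖u‖_{B^s_q}^q`, where `τ = s + d(1/2 - 1/q)`. -/
noncomputable def penaltyGradient {d : ℕ} (τ q : ℝ) (c : Index d → ℝ) (l : Index d) : ℝ :=
  q * 2 ^ (q * τ * l.level) * |c l| ^ (q - 2) * c l

/-- In the coordinates rescaled by `2^(τ|λ|)` the gradient is the derivative of the unweighted
`|t|^q`, so the scalar convexity estimate applies termwise. -/
theorem penaltyGradient_mul {d : ℕ} (τ q : ℝ) (c : Index d → ℝ) (l : Index d) (x : ℝ) :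
    penaltyGradient τ q c l * x =
      q * |2 ^ (τ * l.level) * c l| ^ (q - 2) * (2 ^ (τ * l.level) * c l) *
        (2 ^ (τ * l.level) * x) := by
  have h : (2 : ℝ) ^ (q * τ * l.level) =
      2 ^ ((q - 2) * τ * l.level) * 2 ^ (τ * l.level) * 2 ^ (τ * l.level) := by
    rw [← Real.rpow_add (by norm_num), ← Real.rpow_add (by norm_num)]
    congr 1; ring
  rw [← weight_mul_abs_rpow, penaltyGradient, h]
  ring

theorem abs_rpow_sub_two_mul_self {q : ℝ} (hq : 1 < q) (x : ℝ) :
    |(|x| ^ (q - 2) * x)| = |x| ^ (q - 1) := by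
  rcases eq_or_ne x 0 with rfl | hx
  · simp [Real.zero_rpow (by linarith : q - 1 ≠ 0)]
  · rw [abs_mul, abs_of_nonneg (by positivity), show q - 1 = (q - 2) + 1 by ring,
      Real.rpow_add_one (abs_pos.2 hx).ne']

/-- The source condition: smoothness of `c` makes the derivative of the penalty smooth. -/
theorem seqNorm_penaltyGradient_lt_top {d : ℕ} {sS pS sG pG p sR pR ε : ℝ} (hpS : 0 < pS)
    (hpG : 0 < pG) (hp : 0 < p) (hSp : pS ≤ p) (hε : 0 < ε) (hpR : pR = (p + pG) / pG)
    (hsR : sR ≤ (p * sS - pG * sG) / (p + pG) - d * (1 / (p + pG) * (p / pS - 1))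
      - ε * (p / pS - 1)) {c : Index d → ℝ} (hc : seqNorm sS pS c < ⊤) :
    seqNorm sG pG (penaltyGradient (sR + d * (1 / 2 - 1 / pR)) pR c) < ⊤ := by
  have hpR1 : pR - 1 = p / pG := by rw [hpR]; field_simp; ring
  have hpR_gt : 1 < pR := by have : 0 < p / pG := by positivity
                             linarith
  rw [seqNorm_lt_top_iff_summable hpS] at hc
  have hc' := summable_rpow_of_exponent_le (fun _ => abs_nonneg _) hpS hSp hc
  rw [seqNorm_lt_top_iff_summable hpG]
  refine Summable.of_nonneg_of_le (fun _ => by positivity) (fun l => ?_) (hc'.mul_left (pR ^ pG))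
  set τ := sR + d * (1 / 2 - 1 / pR) with hτ
  -- As `(pR - 1) pG = p`, the `pG`-th power of a gradient coefficient is a multiple of `|c l|^p`;
  -- only the dyadic weights remain to be compared. The `ε` term is nonnegative and is dropped.
  have hexp : pG * (sG + d * (1 / 2 - 1 / pG)) + pG * (pR * τ) ≤
      p * (sS + d * (1 / 2 - 1 / pS)) := by
    have h1 : (p + pG) * sR ≤ p * sS - pG * sG - d * (p / pS - 1) := by
      have h0 : 0 ≤ p / pS - 1 := by rw [sub_nonneg, le_div_iff₀ hpS]; linarith
      have := mul_le_mul_of_nonneg_left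
        (hsR.trans (sub_le_self _ (mul_nonneg hε.le h0))) (by positivity : 0 ≤ p + pG)
      refine this.trans (le_of_eq ?_)
      field_simp
    have h2 : pG * (sG + d * (1 / 2 - 1 / pG)) + pG * (pR * τ) =
        pG * sG + (p + pG) * sR + d * p / 2 - d := by
      rw [hτ, hpR]; field_simp; ring
    have h3 : p * (sS + d * (1 / 2 - 1 / pS)) = p * sS + d * p / 2 - d * (p / pS) := by
      field_simp
      ring
    rw [h2, h3]; linarith
  rw [← weight_mul_abs_rpow, ← weight_mul_abs_rpow]
  have habs : |penaltyGradient τ pR c l| = pR * 2 ^ (pR * τ * l.level) * |c l| ^ (pR - 1) := by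
    rw [← abs_rpow_sub_two_mul_self hpR_gt (c l), penaltyGradient, mul_assoc, abs_mul,
      abs_of_nonneg (by positivity : 0 ≤ pR * (2 : ℝ) ^ (pR * τ * l.level))]
  rw [habs, Real.mul_rpow (by positivity) (by positivity),
    Real.mul_rpow (by positivity) (by positivity), ← Real.rpow_mul (by norm_num),
    ← Real.rpow_mul (abs_nonneg _), hpR1, div_mul_cancel₀ _ hpG.ne']
  have hw : (2 : ℝ) ^ (pG * (sG + d * (1 / 2 - 1 / pG)) * l.level) *
      2 ^ (pR * τ * l.level * pG) ≤ 2 ^ (p * (sS + d * (1 / 2 - 1 / pS)) * l.level) := by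
    rw [← Real.rpow_add (by norm_num)]
    refine Real.rpow_le_rpow_of_exponent_le (by norm_num) ?_
    have := mul_le_mul_of_nonneg_right hexp (Nat.cast_nonneg (α := ℝ) l.level)
    linarith
  have := mul_le_mul_of_nonneg_left hw (by positivity : 0 ≤ pR ^ pG * |c l| ^ p)
  linarith

/-! ### Bregman distance estimates -/

/-- The Bregman distance of the `q`-th power of the `ℓ_q`-norm, `1 < q ≤ 2`, dominates the squared
`ℓ_2`-norm on bounded sets. -/
theorem summable_sq_and_tsum_le_bregman {ι : Type*} {q M : ℝ} (hq : 1 < q) (hq2 : q ≤ 2)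
    (hM : 0 < M) {x y : ι → ℝ} (hx : ∀ i, |x i| ≤ M) (hy : ∀ i, |y i| ≤ M)
    (hxs : Summable fun i => |x i| ^ q) (hys : Summable fun i => |y i| ^ q)
    (hg : Summable fun i => q * |y i| ^ (q - 2) * y i * (x i - y i)) :
    (Summable fun i => (x i - y i) ^ 2) ∧
      q * (q - 1) / 2 * M ^ (q - 2) * ∑' i, (x i - y i) ^ 2 ≤
        ∑' i, |x i| ^ q - ∑' i, |y i| ^ q - ∑' i, q * |y i| ^ (q - 2) * y i * (x i - y i) := by
  have hc : 0 < q * (q - 1) / 2 * M ^ (q - 2) := by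
    have : 0 < q - 1 := by linarith
    positivity
  have hle := fun i => abs_rpow_strong_convexity hq hq2 hM (hy i) (hx i)
  have hr := (hxs.sub hys).sub hg
  have hs : Summable fun i => q * (q - 1) / 2 * M ^ (q - 2) * (x i - y i) ^ 2 :=
    Summable.of_nonneg_of_le (fun i => by positivity) hle hr
  refine ⟨(summable_mul_left_iff hc.ne').1 hs, ?_⟩
  rw [← tsum_mul_left, ← hxs.tsum_sub hys, ← (hxs.sub hys).tsum_sub hg]
  exact hs.tsum_le_tsum hle hr

/-- The estimate of the Bregman distance `D = R - R₀ - inner w (f - v)` that follows from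
minimality under the source condition with source element `w`. -/
theorem bregman_le_of_tikhonov_le {H : Type*} [NormedAddCommGroup H] [InnerProductSpace ℝ H]
    {f v vδ w : H} {R R₀ α δ : ℝ} (hα : 0 < α) (hv : ‖v - vδ‖ ≤ δ)
    (h : ‖f - vδ‖ ^ 2 + α * R ≤ ‖v - vδ‖ ^ 2 + α * R₀) :
    R - R₀ - inner ℝ w (f - v) ≤ δ ^ 2 / α + ‖w‖ * δ + α * ‖w‖ ^ 2 / 4 := by
  have h1 : -inner ℝ w (f - v) ≤ ‖w‖ * (‖f - vδ‖ + δ) := by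
    have h2 := (neg_le_abs _).trans (abs_real_inner_le_norm w (f - v))
    have h3 : ‖f - v‖ ≤ ‖f - vδ‖ + δ := by
      have := norm_sub_le_norm_sub_add_norm_sub f vδ v
      rw [norm_sub_rev vδ v] at this
      linarith
    exact h2.trans (mul_le_mul_of_nonneg_left h3 (norm_nonneg _))
  have h4 : ‖v - vδ‖ ^ 2 ≤ δ ^ 2 := pow_le_pow_left₀ (norm_nonneg _) hv 2
  have h5 : α * (R - R₀ - inner ℝ w (f - v)) ≤
      α * (δ ^ 2 / α + ‖w‖ * δ + α * ‖w‖ ^ 2 / 4) := by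
    have h6 : α * (δ ^ 2 / α) = δ ^ 2 := by field_simp
    -- Completing the square: `α‖w‖t - t² ≤ α²‖w‖²/4` with `t = ‖f - vδ‖`.
    nlinarith [mul_le_mul_of_nonneg_left h1 hα.le, sq_nonneg (‖f - vδ‖ - α * ‖w‖ / 2)]
  exact le_of_mul_le_mul_left h5 hα

end BesovTikhonov

/-! ### The convergence rate -/

open BesovTikhonov in
theorem mainTheorem4
    {d : ℕ} (hd : 0 < d) (W : WaveletBasis d)
    {sD pD sS pS sG pG : ℝ} (hpD : 1 < pD) (hpS : 0 < pS) (hpG : 0 < pG)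
    (F : W.besov sD pD (zero_lt_one.trans hpD) →ₗ[ℝ] L2 d) (hF : W.IsBoundedOp F)
    (hGD : W.EmbedsInDual sG pG hpG sD pD (zero_lt_one.trans hpD))
    (hG : W.besovInDual sG pG sD pD (zero_lt_one.trans hpD) ⊆ Set.range (W.adjoint F))
    (hSD : W.besov sS pS hpS ≤ W.besov sD pD (zero_lt_one.trans hpD))
    (hSG : pS ≤ pG)
    (uTrue : Tempered d) (huS : uTrue ∈ W.besov sS pS hpS)
    (v : L2 d) (hv : F ⟨uTrue, hSD huS⟩ = v)
    {p : ℝ} (hp : 0 < p) (hSp : pS ≤ p) (hpDG : p ≤ min pD pG)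
    {ε : ℝ} (hε : 0 < ε)
    {sR pR σ : ℝ} (hpR : pR = (p + pG) / pG)
    (hsR : sR ≤ (p * sS - pG * sG) / (p + pG) - d * (1 / (p + pG) * (p / pS - 1))
      - ε * (p / pS - 1))
    (hσ : σ = sR + d * (1 / 2 - 1 / pR))
    {c₁ c₂ : ℝ} (hc₁ : 0 < c₁) (hc₂ : 0 < c₂) :
    ∃ K > 0, ∃ δ₀ > 0, ∀ δ : ℝ, 0 < δ → δ ≤ δ₀ → ∀ α : ℝ, c₁ * δ ≤ α → α ≤ c₂ * δ →
      ∀ vδ : L2 d, ‖v - vδ‖ ≤ δ →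
        ∀ u : W.besov sD pD (zero_lt_one.trans hpD), W.IsTikhonovMinimizer F sR pR vδ α u →
          W.sobolevNorm σ ((u : Tempered d) - uTrue) ≤ ENNReal.ofReal (K * Real.sqrt δ) := by
  set a := penaltyGradient σ pR (W.coeff uTrue) with ha
  have hq : 1 < pR := by
    rw [hpR, lt_div_iff₀ hpG]; linarith
  have hq2 : pR ≤ 2 := by
    rw [hpR, div_le_iff₀ hpG]; linarith [hpDG.trans (min_le_right _ _)]
  have hq0 : 0 < pR := zero_lt_one.trans hq
  have haG : seqNorm sG pG a < ⊤ := by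
    rw [ha, hσ]
    exact seqNorm_penaltyGradient_lt_top hpS hpG hp hSp hε hpR hsR huS
  -- The series form of `ξ` on all of `B_D` is needed to evaluate it at `u - u†`, which need not be
  -- a finite wavelet sum.
  obtain ⟨ξ, hξ, hξa⟩ := hGD.exists_mem_besovInDual W haG
  obtain ⟨w, hw⟩ := hG hξ
  set u₀ : W.besov sD pD (zero_lt_one.trans hpD) := ⟨uTrue, hSD huS⟩ with hu₀
  set y : Index d → ℝ := fun l => 2 ^ (σ * l.level) * W.coeff uTrue l with hy
  -- Finiteness of the penalty at `u†` follows from Euler's identity: pairing the gradient with `u†`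
  -- itself gives `pR` times the penalty, and this pairing converges.
  have hys : Summable fun l => |y l| ^ pR := by
    refine (summable_mul_left_iff hq0.ne').1 ((hGD.summable_mul W haG u₀).congr fun l => ?_)
    rw [ha, penaltyGradient_mul, mul_assoc, mul_assoc]
    change pR * (|y l| ^ (pR - 2) * (y l * y l)) = _
    rcases eq_or_ne (y l) 0 with h | h
    · simp [h, Real.zero_rpow hq0.ne']
    · have h' : |y l| ^ pR = |y l| ^ (pR - 2) * |y l| ^ 2 := by
        rw [← Real.rpow_natCast |y l| 2, ← Real.rpow_add (abs_pos.2 h)]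
        congr 1; push_cast; ring
      rw [h', sq_abs]; ring
  set R₀ := ∑' l, |y l| ^ pR with hR₀
  have hR₀nn : 0 ≤ R₀ := tsum_nonneg fun _ => by positivity
  -- Minimality gives `R ≤ R₀ + δ²/α ≤ R₀ + δ/c₁`, and `δ ≤ δ₀ = 1`.
  set B := R₀ + 1 / c₁ with hB
  have hBpos : 0 < B := by positivity
  set M := B ^ (1 / pR) with hM
  have hMpos : 0 < M := by positivity
  have le_M : ∀ z : Index d → ℝ, (Summable fun l => |z l| ^ pR) → ∑' l, |z l| ^ pR ≤ B →
      ∀ l, |z l| ≤ M := by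
    intro z hz hzB l
    have h := (hz.le_tsum l fun _ _ => by positivity).trans hzB
    rw [hM, one_div]
    exact (Real.le_rpow_inv_iff_of_pos (abs_nonneg _) hBpos.le hq0).2 h
  set c := pR * (pR - 1) / 2 * M ^ (pR - 2) with hc
  have hcpos : 0 < c := by
    have : 0 < pR - 1 := by linarith
    positivity
  -- The Bregman bound divided by `δ`, using `δ²/α ≤ δ/c₁` and `α ≤ c₂δ`.
  set E := 1 / c₁ + ‖w‖ + c₂ * ‖w‖ ^ 2 / 4 with hE
  have hEpos : 0 < E := by positivity
  refine ⟨Real.sqrt (E / c), by positivity, 1, one_pos, fun δ hδ hδ1 α hα1 hα2 vδ hvδ u hu => ?_⟩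
  have hαpos : 0 < α := lt_of_lt_of_le (by positivity) hα1
  have hδα : δ ^ 2 / α ≤ δ / c₁ := by
    rw [div_le_div_iff₀ hαpos hc₁, sq, mul_assoc]
    exact mul_le_mul_of_nonneg_left (by linarith) hδ.le
  set x : Index d → ℝ := fun l => 2 ^ (σ * l.level) * W.coeff u l with hx
  have hmin := hu u₀
  have hnorm : ∀ z : Tempered d, W.besovNorm sR pR z ^ pR =
      ∑' l, ENNReal.ofReal (|2 ^ (σ * l.level) * W.coeff z l| ^ pR) := by
    intro z
    rw [hσ]
    exact seqNorm_rpow hq0 _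
  have hnorm0 : W.besovNorm sR pR u₀ ^ pR = ENNReal.ofReal R₀ := by
    rw [hnorm, hR₀, ENNReal.ofReal_tsum_of_nonneg (fun _ => by positivity) hys]
  unfold WaveletBasis.tikhonov at hmin
  rw [hv, hnorm0, ← ofReal_norm, ← ofReal_norm, ← ENNReal.ofReal_pow (norm_nonneg _),
    ← ENNReal.ofReal_pow (norm_nonneg _), ← ENNReal.ofReal_mul hαpos.le,
    ← ENNReal.ofReal_add (by positivity) (by positivity)] at hmin
  -- The functional is finite at `u†`, so an infinite penalty would contradict minimality.
  have hxs : Summable fun l => |x l| ^ pR := by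
    rw [← tsum_ofReal_lt_top_iff fun _ => by positivity, ← hnorm]
    by_contra htop
    rw [not_lt_top_iff.1 htop, ENNReal.mul_top (by simpa using hαpos), add_top, top_le_iff] at hmin
    exact ENNReal.ofReal_ne_top hmin
  set R := ∑' l, |x l| ^ pR with hR
  rw [hnorm, ← ENNReal.ofReal_tsum_of_nonneg (fun _ => by positivity) hxs,
    ← ENNReal.ofReal_mul hαpos.le, ← ENNReal.ofReal_add (by positivity) (by positivity),
    ENNReal.ofReal_le_ofReal_iff (by positivity)] at hmin
  have hRB : R ≤ B := by
    have h1 : ‖v - vδ‖ ^ 2 ≤ δ ^ 2 := pow_le_pow_left₀ (norm_nonneg _) hvδ 2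
    have h2 : α * R ≤ α * (R₀ + δ ^ 2 / α) := by
      rw [mul_add, mul_div_cancel₀ _ hαpos.ne']
      linarith [sq_nonneg ‖F u - vδ‖]
    have h3 : δ / c₁ ≤ 1 / c₁ := by gcongr
    linarith [le_of_mul_le_mul_left h2 hαpos]
  have hterm : ∀ l, a l * W.coeff ((u - u₀ : W.besov sD pD (zero_lt_one.trans hpD)) : Tempered d) l =
      pR * |y l| ^ (pR - 2) * y l * (x l - y l) := by
    intro l
    rw [ha, penaltyGradient_mul]
    simp only [hx, hy, hu₀, WaveletBasis.coeff, Submodule.coe_sub, sub_apply]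
    ring
  obtain ⟨hsq, hbreg⟩ := summable_sq_and_tsum_le_bregman hq hq2 hMpos (le_M x hxs hRB)
    (le_M y hys (le_add_of_nonneg_right (by positivity))) hxs hys
    ((hGD.summable_mul W haG (u - u₀)).congr hterm)
  have hinner : ∑' l, pR * |y l| ^ (pR - 2) * y l * (x l - y l) = inner ℝ w (F u - v) := by
    rw [← tsum_congr hterm, ← hξa, ← hw, W.adjoint_apply, LinearMap.map_sub F u u₀, hv]
  rw [hinner] at hbreg
  have hD := hbreg.trans (bregman_le_of_tikhonov_le (w := w) hαpos hvδ hmin)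
  have hfinal : ∑' l, (x l - y l) ^ 2 ≤ E / c * δ := by
    rw [div_mul_eq_mul_div, le_div_iff₀ hcpos, mul_comm]
    refine hD.trans ?_
    have h1 := mul_le_mul_of_nonneg_right hα2 (sq_nonneg ‖w‖)
    have h2 : E * δ = δ / c₁ + ‖w‖ * δ + c₂ * δ * ‖w‖ ^ 2 / 4 := by rw [hE]; ring
    linarith
  have hsob : W.sobolevNorm σ ((u : Tempered d) - uTrue) ^ (2 : ℝ) =
      ENNReal.ofReal (∑' l, (x l - y l) ^ 2) := by
    rw [ENNReal.ofReal_tsum_of_nonneg (fun _ => by positivity) hsq]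
    refine (seqNorm_rpow zero_lt_two _).trans (tsum_congr fun l => ?_)
    -- For exponent `2` the shift `d(1/2 - 1/2)` vanishes, so `H^σ` carries the same weights
    -- `2^(σ|λ|)` as the penalty.
    rw [Real.rpow_two, sq_abs, sub_self, mul_zero, add_zero]
    simp only [hx, hy, WaveletBasis.coeff, sub_apply]
    ring_nf
  rw [← ENNReal.rpow_le_rpow_iff zero_lt_two, hsob,
    ENNReal.ofReal_rpow_of_nonneg (by positivity) zero_le_two, Real.rpow_two, mul_pow,
    Real.sq_sqrt (by positivity), Real.sq_sqrt hδ.le]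
  exact ENNReal.ofReal_le_ofReal hfinal
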